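/- Let $G$ be a locally compact (Hausdorff) abelian group, written additively, with dual group $\widehat G$ and duality pairing $(x,\gamma)$ for $x\in G$, $\gamma\in\widehat G$. Let $H\subseteq G$ be a compact open subgroup, and let $H^\perp=\{\gamma\in\widehat G : (x,\gamma)=1 \text{ for all } x\in H\}$ be its annihilator. Let $A\in\operatorname{Aut}G$, the group under composition of homeomorphic automorphisms of $G$ onto itself, and let $A^*\in\operatorname{Aut}\widehat G$ be its adjoint, defined by $(Ax,\gamma)=(x,A^*\gamma)$ for all $x\in G$, $\gamma\in\widehat G$. Then: (a) $H\subseteq AH$ if and only if $H^\perp\subseteq A^*H^\perp$. (b) $H\subsetneq AH$ if and only if $H^\perp\subsetneq A^*H^\perp$. (c) If $H\subseteq AH$, then $$\bigcap_{n\le 0}A^nH=\{0\}\iff\bigcup_{n\ge 0}(A^*)^nH^\perp=\widehat G,$$ where $n$ ranges over the integers. In particular, $A$ is expansive with respect to $H$ (that is, $H\subsetneq AH$ and $\bigcap_{n\le 0}A^nH=\{0\}$) if and only if $H^\perp\subsetneq A^*H^\perp$ and $\bigcup_{n\ge 0}(A^*)^nH^\perp=\widehat G$. -/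

import Mathlib

namespace LCAGroup

/-- `Aut G`: the homeomorphic automorphisms of the topological abelian group `G`. -/
abbrev Aut (G : Type*) [AddCommGroup G] [TopologicalSpace G] : Type _ := G ≃ₜ+ G

/-- `Aut G` is a group under composition: `(A * B) x = A (B x)`, and `A⁻¹` is the inverse map. -/
instance instGroupAut (G : Type*) [AddCommGroup G] [TopologicalSpace G] : Group (Aut G) where
  mul A B := ContinuousAddEquiv.trans B A
  one := ContinuousAddEquiv.refl G
  inv A := ContinuousAddEquiv.symm A
  mul_assoc _ _ _ := rfl
  one_mul _ := rfl
  mul_one _ := rfl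
  inv_mul_cancel A := ContinuousAddEquiv.ext A.symm_apply_apply

/-- The dual group `Ĝ` of continuous homomorphisms from `G` to the circle, written additively,
with the compact-open topology. -/
abbrev Dual (G : Type*) [AddCommGroup G] [TopologicalSpace G] : Type _ :=
  Additive (PontryaginDual (Multiplicative G))

/-- The duality pairing `(x, γ)`, with values in the unit circle. -/
noncomputable def pairing {G : Type*} [AddCommGroup G] [TopologicalSpace G]
    (x : G) (γ : Dual G) : Circle :=
  (Additive.toMul γ) (Multiplicative.ofAdd x)

section basic

variable {G : Type*} [AddCommGroup G] [TopologicalSpace G]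

theorem pairing_zero_right (x : G) : pairing x (0 : Dual G) = 1 := rfl

theorem pairing_add_right (x : G) (γ δ : Dual G) :
    pairing x (γ + δ) = pairing x γ * pairing x δ := rfl

theorem pairing_neg_right (x : G) (γ : Dual G) : pairing x (-γ) = (pairing x γ)⁻¹ := rfl

theorem dual_ext {γ δ : Dual G} (h : ∀ x : G, pairing x γ = pairing x δ) : γ = δ :=
  PontryaginDual.ext h

end basic

/-- The annihilator `H^⊥ = {γ ∈ Ĝ : (x, γ) = 1 for all x ∈ H}` of a subgroup `H`. -/
def annihilator {G : Type*} [AddCommGroup G] [TopologicalSpace G] (H : AddSubgroup G) :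
    AddSubgroup (Dual G) where
  carrier := {γ | ∀ x ∈ H, pairing x γ = 1}
  zero_mem' := fun _ _ => rfl
  add_mem' := fun hγ hδ x hx => by rw [pairing_add_right, hγ x hx, hδ x hx, one_mul]
  neg_mem' := fun hγ x hx => by rw [pairing_neg_right, hγ x hx, inv_one]

/-- `A ∈ Aut G` viewed as a continuous endomorphism of `G` written multiplicatively. -/
def toMulHom {G : Type*} [AddCommGroup G] [TopologicalSpace G] (A : Aut G) :
    Multiplicative G →ₜ* Multiplicative G where
  toMonoidHom := AddMonoidHom.toMultiplicative (A : G →+ G)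
  continuous_toFun := A.continuous_toFun

/-- The adjoint `A* ∈ Aut Ĝ` of `A ∈ Aut G`, determined by `(A x, γ) = (x, A* γ)`. -/
noncomputable def adjoint {G : Type*} [AddCommGroup G] [TopologicalSpace G] (A : Aut G) :
    Aut (Dual G) where
  toFun γ := Additive.ofMul (PontryaginDual.map (toMulHom A) γ.toMul)
  invFun γ := Additive.ofMul (PontryaginDual.map (toMulHom A⁻¹) γ.toMul)
  left_inv γ := dual_ext fun x => congrArg (fun y => pairing y γ) (A.apply_symm_apply x)
  right_inv γ := dual_ext fun x => congrArg (fun y => pairing y γ) (A.symm_apply_apply x)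
  map_add' _ _ := rfl
  continuous_toFun := (PontryaginDual.map (toMulHom A)).continuous_toFun
  continuous_invFun := (PontryaginDual.map (toMulHom A⁻¹)).continuous_toFun

theorem pairing_adjoint {G : Type*} [AddCommGroup G] [TopologicalSpace G] (A : Aut G)
    (x : G) (γ : Dual G) : pairing (A x) γ = pairing x (adjoint A γ) := rfl

/-- `A` is expansive with respect to the (compact open) subgroup `H`: `H ⊊ A H`, and
the intersection of the `Aⁿ H` over all integers `n ≤ 0` is `{0}`. -/
def IsExpansive {G : Type*} [AddCommGroup G] [TopologicalSpace G]
    (A : Aut G) (H : AddSubgroup G) : Prop :=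
  (H : Set G) ⊂ A '' (H : Set G) ∧
    (⋂ n : ℤ, ⋂ _ : n ≤ 0, (A ^ n : Aut G) '' (H : Set G)) = {0}

end LCAGroup

/-! The adjoint carries `H^⊥` to `(A⁻¹H)^⊥` (`image_adjoint_annihilator`). An open `H` is recovered
from `H^⊥`: characters of the discrete group `G/H` separate points and pull back to continuous ones.
So annihilators of open subgroups reverse inclusions faithfully (`annihilator_le_annihilator_iff`),
which gives (a) and (b).

For (c), the compact groups `K n = A⁻ⁿH` decrease and `(A*)ⁿH^⊥ = (K n)^⊥`. If they meet in `{0}`,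
each character sends some `K n` into a small arc, hence to `1`. Conversely, if the annihilators
cover the dual, every character kills `⋂ K n ⊆ H`; it remains that characters of `G` separate points
of `H` (`exists_pairing_ne_one`). Those of the compact group `H` do, by a Peter–Weyl argument
(`exists_character_ne_one`), and they extend to `G` because the circle is divisible and `H` is open.
-/

/-! ### Compact operators commuting with a unitary representation. -/

open MeasureTheory InnerProductSpace in
/-- The average of the rank one operators attached to the orbit of a vector under a strongly
continuous unitary representation of a compact group. -/
noncomputable def orbitOperator {K E : Type*} [Group K] [MeasurableSpace K]
    [NormedAddCommGroup E] [InnerProductSpace ℂ E]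
    (μ : Measure K) (ρ : K →* (E ≃ₗᵢ[ℂ] E)) (f : E) : E →L[ℂ] E :=
  ∫ y, rankOne ℂ (ρ y f) (ρ y f) ∂μ

section OrbitOperator

open MeasureTheory InnerProductSpace

variable {K E : Type*} [Group K] [TopologicalSpace K]
  [CompactSpace K] [MeasurableSpace K] [BorelSpace K]
  [NormedAddCommGroup E] [InnerProductSpace ℂ E] [CompleteSpace E]
  {μ : Measure K} [IsFiniteMeasure μ] {ρ : K →* (E ≃ₗᵢ[ℂ] E)}

omit [CompactSpace K] [MeasurableSpace K] [BorelSpace K] in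
theorem continuous_rankOne_orbit (hρ : ∀ v, Continuous fun y => ρ y v) (f : E) :
    Continuous fun y => rankOne ℂ (ρ y f) (ρ y f) :=
  (ContinuousLinearMap.smulRightL ℂ E E).continuous₂.comp
    (((innerSL ℂ).continuous.comp (hρ f)).prodMk (hρ f))

theorem integrable_rankOne_orbit (hρ : ∀ v, Continuous fun y => ρ y v) (f : E) :
    Integrable (fun y => rankOne ℂ (ρ y f) (ρ y f)) μ :=
  (continuous_rankOne_orbit hρ f).integrable_of_hasCompactSupport
    (HasCompactSupport.of_compactSpace _)

theorem orbitOperator_apply (hρ : ∀ v, Continuous fun y => ρ y v) (f v : E) :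
    orbitOperator μ ρ f v = ∫ y, inner ℂ (ρ y f) v • ρ y f ∂μ :=
  ContinuousLinearMap.integral_apply (integrable_rankOne_orbit hρ f) v

theorem inner_orbitOperator (hρ : ∀ v, Continuous fun y => ρ y v) (f v w : E) :
    inner ℂ w (orbitOperator μ ρ f v) = ∫ y, inner ℂ (ρ y f) v * inner ℂ w (ρ y f) ∂μ := by
  rw [orbitOperator_apply hρ]
  have hi : Integrable (fun y => inner ℂ (ρ y f) v • ρ y f) μ :=
    (integrable_rankOne_orbit hρ f).apply_continuousLinearMap v
  rw [← innerSL_apply_apply ℂ, ← (innerSL ℂ w).integral_comp_comm hi]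
  simp

theorem isSymmetric_orbitOperator (hρ : ∀ v, Continuous fun y => ρ y v) (f : E) :
    (orbitOperator μ ρ f).IsSymmetric := by
  intro v w
  change inner ℂ (orbitOperator μ ρ f v) w = inner ℂ v (orbitOperator μ ρ f w)
  rw [← inner_conj_symm, inner_orbitOperator hρ, inner_orbitOperator hρ, ← integral_conj]
  congr 1 with y
  simp [mul_comm]

omit [CompleteSpace E] in
theorem isCompactOperator_rankOne (a b : E) : IsCompactOperator (rankOne ℂ a b : E →L[ℂ] E) := by
  rw [rankOne_def']
  have h : IsCompactOperator (innerSL ℂ b : E →L[ℂ] ℂ) := by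
    refine ⟨Metric.closedBall 0 1, isCompact_closedBall 0 1, ?_⟩
    exact (innerSL ℂ b).continuous.continuousAt.preimage_mem_nhds
      (by simpa using Metric.closedBall_mem_nhds (0 : ℂ) one_pos)
  exact h.clm_comp (.toSpanSingleton ℂ a)

/-- Compact operators form a closed convex set, which contains the mean of any integrable family in
it. -/
theorem isCompactOperator_orbitOperator [IsProbabilityMeasure μ]
    (hρ : ∀ v, Continuous fun y => ρ y v) (f : E) :
    IsCompactOperator (orbitOperator μ ρ f) := by
  let C := compactOperator (RingHom.id ℂ) E E
  have hC : IsClosed (C : Set (E →L[ℂ] E)) := by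
    rw [show C = C.topologicalClosure from compactOperator_topologicalClosure.symm]
    exact Submodule.isClosed_topologicalClosure _
  have hconv : Convex ℝ (C : Set (E →L[ℂ] E)) := (C.restrictScalars ℝ).convex
  exact hconv.integral_mem hC (.of_forall fun y => isCompactOperator_rankOne _ _)
    (integrable_rankOne_orbit hρ f)

/-- The form `⟨f, S f⟩` is the integral of `|⟨ρ y f, f⟩|²`, continuous and positive at `y = 1`. -/
theorem orbitOperator_ne_zero [IsTopologicalGroup K] [μ.IsOpenPosMeasure]
    (hρ : ∀ v, Continuous fun y => ρ y v) {f : E} (hf : f ≠ 0) :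
    orbitOperator μ ρ f ≠ 0 := by
  intro h0
  have h1 := inner_orbitOperator (μ := μ) hρ f f f
  have hc : Continuous fun y => ‖(inner ℂ (ρ y f) f : ℂ)‖ ^ 2 :=
    ((hρ f).inner continuous_const).norm.pow 2
  have h2 : ∫ y, ‖(inner ℂ (ρ y f) f : ℂ)‖ ^ 2 ∂μ = 0 := by
    have : ∀ y, (inner ℂ (ρ y f) f * inner ℂ f (ρ y f) : ℂ)
        = ((‖(inner ℂ (ρ y f) f : ℂ)‖ ^ 2 : ℝ) : ℂ) := fun y => by
      rw [← inner_conj_symm f, Complex.mul_conj']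
      push_cast
      rfl
    simp_rw [this] at h1
    rw [integral_complex_ofReal, h0] at h1
    simpa using h1.symm
  have hpos : 0 < ∫ y, ‖(inner ℂ (ρ y f) f : ℂ)‖ ^ 2 ∂μ :=
    hc.integral_pos_of_hasCompactSupport_nonneg_nonzero (HasCompactSupport.of_compactSpace _)
      (fun y => by positivity) (x := 1) (by simpa using hf)
  exact hpos.ne' h2

theorem orbitOperator_comm [IsTopologicalGroup K] [μ.IsMulLeftInvariant]
    (hρ : ∀ v, Continuous fun y => ρ y v) (f : E) (z : K) (v : E) :
    orbitOperator μ ρ f (ρ z v) = ρ z (orbitOperator μ ρ f v) := by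
  refine ext_inner_left ℂ fun w => ?_
  obtain ⟨w, rfl⟩ := (ρ z).surjective w
  rw [(ρ z).inner_map_map, inner_orbitOperator hρ, inner_orbitOperator hρ,
    ← integral_mul_left_eq_self _ z]
  congr 1 with y
  have h : ρ (z * y) f = ρ z (ρ y f) := by rw [map_mul]; rfl
  rw [h, (ρ z).inner_map_map, (ρ z).inner_map_map]

end OrbitOperator

/-- Commuting endomorphisms preserving a nonzero finite-dimensional complex subspace have a common
eigenvector in it. -/
theorem exists_common_eigenvector {ι E : Type*} [AddCommGroup E] [Module ℂ E]
    (T : ι → Module.End ℂ E) (hT : ∀ i j, Commute (T i) (T j)) (V : Submodule ℂ E)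
    [FiniteDimensional ℂ V] (hV : V ≠ ⊥) (hTV : ∀ i, ∀ v ∈ V, T i v ∈ V) :
    ∃ v ∈ V, v ≠ 0 ∧ ∀ i, ∃ c : ℂ, T i v = c • v := by
  -- A member of least dimension lies in a single eigenspace of each `T i`, so any nonzero vector of
  -- it will do.
  let P : Set (Submodule ℂ E) := {W | W ≤ V ∧ W ≠ ⊥ ∧ ∀ i, ∀ v ∈ W, T i v ∈ W}
  obtain ⟨W, ⟨hWV, hW, hTW⟩, hmin⟩ :=
    (measure fun W : Submodule ℂ E => Module.finrank ℂ W).wf.has_min P ⟨V, le_rfl, hV, hTV⟩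
  have : FiniteDimensional ℂ W := Submodule.finiteDimensional_of_le hWV
  have : Nontrivial W := Submodule.nontrivial_iff_ne_bot.mpr hW
  obtain ⟨v, hv, hv0⟩ := W.ne_bot_iff.mp hW
  refine ⟨v, hWV hv, hv0, fun i => ?_⟩
  obtain ⟨c, hc⟩ := Module.End.exists_eigenvalue ((T i).restrict (hTW i))
  obtain ⟨u, hu⟩ := hc.exists_hasEigenvector
  have huc : T i u = c • (u : E) := congrArg Subtype.val hu.apply_eq_smul
  let W' := W ⊓ (T i).eigenspace c
  have hW' : W' ∈ P := by
    refine ⟨inf_le_left.trans hWV, ?_, fun j w hw => ⟨hTW j w hw.1, ?_⟩⟩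
    · refine W'.ne_bot_iff.mpr ⟨u, ⟨u.2, Module.End.mem_eigenspace_iff.mpr huc⟩, ?_⟩
      simpa using hu.2
    · exact Module.End.mapsTo_genEigenspace_of_comm (hT i j) c 1 hw.2
  have heq : W' = W := by
    refine Submodule.eq_of_le_of_finrank_le inf_le_left ?_
    exact not_lt.mp (hmin W' hW')
  exact ⟨c, Module.End.mem_eigenspace_iff.mp (heq.ge hv).2⟩

/-- If an element acts nontrivially in a strongly continuous unitary representation of a compact
abelian group, some continuous character takes a nontrivial value on it. -/
theorem exists_character_of_unitary_rep {K E : Type*} [CommGroup K] [TopologicalSpace K]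
    [IsTopologicalGroup K] [CompactSpace K] [NormedAddCommGroup E] [InnerProductSpace ℂ E]
    [CompleteSpace E] (ρ : K →* (E ≃ₗᵢ[ℂ] E)) (hρ : ∀ v, Continuous fun y => ρ y v)
    {x : K} {u : E} (hu : ρ x u ≠ u) : ∃ χ : K →ₜ* Circle, χ x ≠ 1 := by
  borelize K
  let μ : MeasureTheory.Measure K := MeasureTheory.Measure.haarMeasure ⊤
  have : MeasureTheory.IsProbabilityMeasure μ :=
    ⟨MeasureTheory.Measure.haarMeasure_self (K₀ := ⊤)⟩
  have happ (y z : K) (v : E) : ρ (y * z) v = ρ y (ρ z v) := by rw [map_mul]; rfl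
  have hcomm (y z : K) (v : E) : ρ y (ρ z v) = ρ z (ρ y v) := by
    rw [← happ, ← happ, mul_comm]
  -- This choice makes the orbit of `f` orthogonal to every vector fixed by `ρ x`; such vectors lie
  -- in the kernel of `S`, not in an eigenspace for `c ≠ 0`.
  let f := u - ρ x u
  have hf : f ≠ 0 := sub_ne_zero.mpr hu.symm
  let S := orbitOperator μ ρ f
  have hS : IsCompactOperator S := isCompactOperator_orbitOperator hρ f
  obtain ⟨c, hc, hc0⟩ : ∃ c, Module.End.HasEigenvalue (S : Module.End ℂ E) c ∧ c ≠ 0 := by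
    by_contra! h
    exact orbitOperator_ne_zero hρ hf
      ((ContinuousLinearMap.eq_zero_of_forall_hasEigenvalue_eq_zero hS
        (isSymmetric_orbitOperator hρ f)).mp h)
  have := ContinuousLinearMap.finite_dimensional_eigenspace hS c hc0
  obtain ⟨v, hvS, hv0, hv⟩ := exists_common_eigenvector
    (fun y => (ρ y).toLinearEquiv.toLinearMap) (fun y z => LinearMap.ext fun w => hcomm y z w)
    (Module.End.eigenspace S.toLinearMap c) hc fun y w hw => by
      rw [Module.End.mem_eigenspace_iff] at hw ⊢
      change S (ρ y w) = c • ρ y w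
      rw [← map_smul, ← hw]
      exact orbitOperator_comm hρ f y w
  choose χ hχ using hv
  replace hχ (y : K) : ρ y v = χ y • v := hχ y
  have hχ_norm (y : K) : ‖χ y‖ = 1 := by
    have := (ρ y).norm_map v
    rw [hχ, norm_smul] at this
    exact mul_right_cancel₀ (norm_ne_zero_iff.mpr hv0) (by rw [this, one_mul])
  have hχ_inner (y : K) : χ y = inner ℂ v (ρ y v) / inner ℂ v v := by
    rw [hχ, inner_smul_right, mul_div_cancel_right₀ _ (inner_self_ne_zero.mpr hv0)]
  have hχ_cont : Continuous χ := by
    rw [funext hχ_inner]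
    exact (continuous_const.inner (hρ v)).div_const _
  refine ⟨⟨⟨⟨fun y => ⟨χ y, mem_sphere_zero_iff_norm.mpr (hχ_norm y)⟩, ?_⟩, ?_⟩,
    hχ_cont.subtype_mk _⟩, fun h => ?_⟩
  · refine Subtype.ext (smul_left_injective ℂ hv0 ?_)
    change χ 1 • v = (1 : ℂ) • v
    rw [← hχ, map_one, one_smul]
    rfl
  · intro y z
    refine Subtype.ext (smul_left_injective ℂ hv0 ?_)
    change χ (y * z) • v = (χ y * χ z) • v
    rw [← hχ, happ, hχ z, map_smul, hχ y, smul_smul, mul_comm]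
  · have hx : ρ x v = v := by
      rw [hχ, show χ x = 1 from congrArg Subtype.val h, one_smul]
    have hzero (y : K) : inner ℂ (ρ y f) v = 0 := by
      rw [show f = u - ρ x u from rfl, map_sub, inner_sub_left, hcomm y x u]
      nth_rewrite 2 [← hx]
      rw [(ρ x).inner_map_map, sub_self]
    have hSv : S v = 0 := by
      rw [orbitOperator_apply hρ]
      simp [hzero]
    have : c • v = 0 := (Module.End.mem_eigenspace_iff.mp hvS).symm.trans hSv
    exact (smul_ne_zero hc0 hv0) this

/-! ### Characters of a compact abelian group, from translations on `L²`. -/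

section RegularRepresentation

open MeasureTheory

/-- The translation action of an abelian group on `L²` as a unitary representation. -/
noncomputable def translationRep {K : Type*} [CommGroup K] [TopologicalSpace K]
    [IsTopologicalGroup K] [MeasurableSpace K] [BorelSpace K] (μ : Measure K)
    [μ.IsMulLeftInvariant] : K →* (Lp ℂ 2 μ ≃ₗᵢ[ℂ] Lp ℂ 2 μ) where
  toFun y :=
    { toFun := fun v => DomMulAct.mk y • v
      invFun := fun v => DomMulAct.mk y⁻¹ • v
      left_inv := fun v => by simp [smul_smul]
      right_inv := fun v => by simp [smul_smul]
      map_add' := fun v w => smul_add _ v w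
      map_smul' := fun c v => smul_comm _ c v
      norm_map' := fun v => DomMulAct.norm_smul_Lp _ v }
  map_one' := LinearIsometryEquiv.ext fun v => one_smul (DomMulAct K) v
  map_mul' y z := LinearIsometryEquiv.ext fun v => by
    change DomMulAct.mk (y * z) • v = DomMulAct.mk y • DomMulAct.mk z • v
    rw [smul_smul, ← DomMulAct.mk_mul, mul_comm]

/-- The continuous characters of a compact Hausdorff abelian group separate points. -/
theorem exists_character_ne_one {K : Type*} [CommGroup K] [TopologicalSpace K]
    [IsTopologicalGroup K] [CompactSpace K] [T2Space K] {x : K} (hx : x ≠ 1) :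
    ∃ χ : K →ₜ* Circle, χ x ≠ 1 := by
  borelize K
  let μ : Measure K := Measure.haarMeasure ⊤
  have : μ.Regular := Measure.regular_haarMeasure
  have : Fact ((2 : ENNReal) ≠ ⊤) := ⟨ENNReal.ofNat_ne_top⟩
  have hcont (v : Lp ℂ 2 μ) : Continuous fun y => translationRep μ y v :=
    (DomMulAct.continuous_mk).smul continuous_const
  obtain ⟨g, hg1, hgx⟩ : ∃ g : C(K, ℝ), g 1 = 0 ∧ g x = 1 := by
    obtain ⟨g, h0, h1, -⟩ := exists_continuous_zero_one_of_isClosed (isClosed_singleton (x := 1))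
      (isClosed_singleton (x := x)) (by simpa using hx.symm)
    exact ⟨g, h0 rfl, h1 rfl⟩
  let h : C(K, ℂ) := ⟨fun y => (g y : ℂ), by fun_prop⟩
  have hmem : MemLp h 2 μ :=
    h.continuous.memLp_of_hasCompactSupport (HasCompactSupport.of_compactSpace _)
  refine exists_character_of_unitary_rep (translationRep μ) hcont (u := hmem.toLp h) fun heq => ?_
  change DomMulAct.mk x • hmem.toLp h = hmem.toLp h at heq
  rw [DomMulAct.mk_smul_toLp, MemLp.toLp_eq_toLp_iff] at heq
  -- At `1` the translate takes the value `h x = 1`, whereas `h 1 = 0`.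
  have := congrFun (Continuous.ae_eq_iff_eq μ (by fun_prop) (by fun_prop) |>.mp heq) 1
  simp [h, hg1, hgx] at this

end RegularRepresentation

/-! ### Circle-valued homomorphisms of abstract abelian groups. -/

/-- Every root in the circle group can be extracted. -/
noncomputable instance Circle.divisibleByInt : DivisibleBy (Additive Circle) ℤ :=
  AddCommGroup.divisibleByIntOfSMulTopEqTop _ fun {n} hn => by
    refine (AddSubgroup.eq_top_iff' _).mpr fun z => ?_
    refine ⟨Additive.ofMul (Circle.exp (Complex.arg (z.toMul : ℂ) / n)), trivial, ?_⟩
    change Circle.exp (Complex.arg (z.toMul : ℂ) / n) ^ n = z.toMul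
    rw [← Circle.exp_zsmul, zsmul_eq_mul, mul_div_cancel₀ _ (by exact_mod_cast hn),
      Circle.exp_arg]

theorem AddSubgroup.exists_circle_extension {D : Type*} [AddCommGroup D] (B : AddSubgroup D)
    (φ : B →+ Additive Circle) : ∃ ψ : D →+ Additive Circle, ∀ b : B, ψ b = φ b := by
  obtain ⟨ψ, hψ⟩ := (Module.Baer.of_divisible (Additive Circle)).extension_property_addMonoidHom
    B.subtype B.subtype_injective φ
  exact ⟨ψ, fun b => DFunLike.congr_fun hψ b⟩

/-- Homomorphisms to the circle separate the points of an abelian group. -/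
theorem exists_circle_hom_ne_zero {D : Type*} [AddCommGroup D] {a : D} (ha : a ≠ 0) :
    ∃ φ : D →+ Additive Circle, φ a ≠ 0 := by
  obtain ⟨c, hc⟩ := CharacterModule.exists_character_apply_ne_zero_of_ne_zero ha
  -- The map `q ↦ exp(2πiq)` has kernel `ℤ`, so it embeds `ℚ/ℤ` in the circle.
  let e : ℚ →+ Additive Circle :=
    Circle.expHom.comp ((AddMonoidHom.mulLeft (2 * Real.pi)).comp (Rat.castHom ℝ).toAddMonoidHom)
  have he (q : ℚ) : e q = 0 ↔ q ∈ AddSubgroup.zmultiples (1 : ℚ) := by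
    change Circle.exp (2 * Real.pi * (q : ℝ)) = 1 ↔ _
    rw [Circle.exp_eq_one, AddSubgroup.mem_zmultiples_iff]
    refine exists_congr fun n => ?_
    rw [mul_comm, mul_left_inj' Real.two_pi_pos.ne']
    simp only [zsmul_eq_mul, mul_one]
    rw [eq_comm]
    exact_mod_cast Iff.rfl
  let E : AddCircle (1 : ℚ) →+ Additive Circle :=
    QuotientAddGroup.lift _ e fun q hq => (he q).mpr hq
  refine ⟨E.comp c, fun h => hc ?_⟩
  obtain ⟨q, hq⟩ := QuotientAddGroup.mk_surjective (c a)
  have hEq : E (c a) = 0 := h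
  rw [← hq] at hEq ⊢
  exact (QuotientAddGroup.eq_zero_iff q).mpr ((he q).mp hEq)

namespace LCAGroup

/-! ### Annihilators and separation of points. -/

section Duality

variable {G : Type*} [AddCommGroup G] [TopologicalSpace G]

theorem continuous_pairing (γ : Dual G) : Continuous fun x : G => pairing x γ :=
  (map_continuous γ.toMul).comp continuous_ofAdd

theorem pairing_nsmul_left (n : ℕ) (x : G) (γ : Dual G) : pairing (n • x) γ = pairing x γ ^ n :=
  map_pow γ.toMul (Multiplicative.ofAdd x) n

/-- A homomorphism to the circle which is continuous on an open subgroup is a character. -/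
theorem exists_dual_of_continuous_restrict [IsTopologicalAddGroup G] {H : AddSubgroup G}
    (hH : IsOpen (H : Set G)) (ψ : G →+ Additive Circle)
    (hψ : Continuous fun x : H => (ψ x).toMul) :
    ∃ γ : Dual G, ∀ x, pairing x γ = (ψ x).toMul := by
  have hcont : Continuous (AddMonoidHom.toMultiplicativeLeft ψ) := by
    refine continuous_of_continuousAt_one _ ?_
    have h0 : ContinuousAt (fun x : G => (ψ x).toMul) 0 :=
      (hH.isOpenEmbedding_subtypeVal.continuousAt_iff (x := (0 : H))).mp hψ.continuousAt
    exact h0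
  let γ : Multiplicative G →ₜ* Circle := ⟨AddMonoidHom.toMultiplicativeLeft ψ, hcont⟩
  exact ⟨Additive.ofMul γ, fun x => rfl⟩

theorem mem_of_forall_mem_annihilator [IsTopologicalAddGroup G] {H : AddSubgroup G}
    (hH : IsOpen (H : Set G)) {x : G} (hx : ∀ γ ∈ annihilator H, pairing x γ = 1) : x ∈ H := by
  by_contra hxH
  obtain ⟨φ, hφ⟩ := exists_circle_hom_ne_zero (D := G ⧸ H) (a := x)
    (mt (QuotientAddGroup.eq_zero_iff x).mp hxH)
  have h1 (y : G) (hy : y ∈ H) : φ.comp (QuotientAddGroup.mk' H) y = 0 := by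
    have : (y : G ⧸ H) = 0 := (QuotientAddGroup.eq_zero_iff y).mpr hy
    simp [this]
  obtain ⟨γ, hγ⟩ := exists_dual_of_continuous_restrict hH (φ.comp (QuotientAddGroup.mk' H)) (by
    simp_rw [fun y : H => h1 y y.2]
    exact continuous_const)
  refine hφ ((hγ x).symm.trans (hx γ fun y hy => ?_))
  rw [hγ, h1 y hy]
  rfl

theorem annihilator_le_annihilator_iff [IsTopologicalAddGroup G] {H K : AddSubgroup G}
    (hH : IsOpen (H : Set G)) : annihilator H ≤ annihilator K ↔ K ≤ H :=
  ⟨fun h _ hx => mem_of_forall_mem_annihilator hH fun _ hγ => h hγ _ hx,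
    fun h _ hγ x hx => hγ x (h hx)⟩

/-- The characters of `G` separate the points of a compact open subgroup. -/
theorem exists_pairing_ne_one [IsTopologicalAddGroup G] [T2Space G] {H : AddSubgroup G}
    (hHc : IsCompact (H : Set G)) (hHo : IsOpen (H : Set G)) {x : G} (hx : x ∈ H) (hx0 : x ≠ 0) :
    ∃ γ : Dual G, pairing x γ ≠ 1 := by
  have : CompactSpace H := isCompact_iff_compactSpace.mp hHc
  have : CompactSpace (Multiplicative H) := this
  have : T2Space (Multiplicative H) := inferInstanceAs (T2Space H)
  obtain ⟨χ, hχ⟩ := exists_character_ne_one (K := Multiplicative H)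
    (x := Multiplicative.ofAdd ⟨x, hx⟩) fun h => hx0 (congrArg Subtype.val h)
  obtain ⟨ψ, hψ⟩ := H.exists_circle_extension (MonoidHom.toAdditiveRight χ.toMonoidHom)
  obtain ⟨γ, hγ⟩ := exists_dual_of_continuous_restrict hHo ψ (by
    simp_rw [hψ]
    exact χ.continuous_toFun.comp continuous_ofAdd)
  refine ⟨γ, fun h => hχ ?_⟩
  rw [hγ, hψ ⟨x, hx⟩] at h
  exact h

/-- A character is trivial on some term of a decreasing sequence
of compact subgroups with trivial intersection. -/
theorem exists_mem_annihilator_of_iInter_eq [T2Space G] {K : ℕ → AddSubgroup G} (hK : Antitone K)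
    (hKc : ∀ n, IsCompact (K n : Set G)) (h0 : ⋂ n, (K n : Set G) = {0}) (γ : Dual G) :
    ∃ n, γ ∈ annihilator (K n) := by
  -- This arc contains all powers of no element but `1`, so a subgroup mapped into it is mapped to
  -- `1`.
  have hU : IsOpen {x : G | pairing x γ ∈ Circle.centeredArc (Real.pi / 2)} :=
    (Circle.isOpen_centeredArc _).preimage (continuous_pairing γ)
  have hzero : pairing (0 : G) γ = 1 := map_one γ.toMul
  obtain ⟨n, hn⟩ := exists_subset_nhds_of_isCompact' (V := fun n => (K n : Set G))
    (directed_of_isDirected_le fun i j hij => hK hij) hKc (fun n => (hKc n).isClosed)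
    (U := {x : G | pairing x γ ∈ Circle.centeredArc (Real.pi / 2)}) fun x hx => by
      rw [h0, Set.mem_singleton_iff] at hx
      subst hx
      refine hU.mem_nhds ?_
      change pairing (0 : G) γ ∈ Circle.centeredArc (Real.pi / 2)
      rw [hzero, Circle.mem_centeredArc (by linarith [Real.pi_pos])]
      simp [Real.pi_pos]
  refine ⟨n, fun x hx => Circle.eq_one_of_forall_pow_mem_centeredArc_pi_div_two fun m _ => ?_⟩
  rw [← pairing_nsmul_left]
  exact hn ((K n).nsmul_mem hx m)

end Duality

/-! ### Automorphisms and their adjoints. -/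

section Automorphism

variable {G : Type*} [AddCommGroup G] [TopologicalSpace G]

/-- The image of a subgroup under an automorphism. -/
def imageSubgroup (A : Aut G) (H : AddSubgroup G) : AddSubgroup G := H.map (A : G →+ G)

theorem coe_imageSubgroup (A : Aut G) (H : AddSubgroup G) :
    (imageSubgroup A H : Set G) = A '' H := rfl

theorem mul_apply (A B : Aut G) (x : G) : (A * B) x = A (B x) := rfl

theorem inv_apply_self (A : Aut G) (x : G) : A⁻¹ (A x) = x := A.symm_apply_apply x

theorem apply_inv_self (A : Aut G) (x : G) : A (A⁻¹ x) = x := A.apply_symm_apply x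

theorem isOpen_imageSubgroup (A : Aut G) {H : AddSubgroup G} (hH : IsOpen (H : Set G)) :
    IsOpen (imageSubgroup A H : Set G) :=
  A.toHomeomorph.isOpenMap _ hH

theorem isCompact_imageSubgroup (A : Aut G) {H : AddSubgroup G} (hH : IsCompact (H : Set G)) :
    IsCompact (imageSubgroup A H : Set G) :=
  hH.image A.continuous_toFun

theorem imageSubgroup_inv_le_iff (A : Aut G) {H K : AddSubgroup G} :
    imageSubgroup A⁻¹ H ≤ K ↔ (H : Set G) ⊆ A '' K := by
  constructor
  · exact fun h x hx => ⟨A⁻¹ x, h ⟨x, hx, rfl⟩, apply_inv_self A x⟩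
  · rintro h _ ⟨x, hx, rfl⟩
    obtain ⟨y, hy, rfl⟩ := h hx
    exact (inv_apply_self A y).symm ▸ hy

theorem le_imageSubgroup_inv_iff (A : Aut G) {H K : AddSubgroup G} :
    K ≤ imageSubgroup A⁻¹ H ↔ A '' (K : Set G) ⊆ H := by
  constructor
  · rintro h _ ⟨x, hx, rfl⟩
    obtain ⟨y, hy, rfl⟩ := h hx
    exact (apply_inv_self A y).symm ▸ hy
  · exact fun h x hx => ⟨A x, h ⟨x, hx, rfl⟩, inv_apply_self A x⟩

theorem adjoint_zpow (A : Aut G) (n : ℤ) : adjoint A ^ n = adjoint (A ^ n) := by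
  -- Taking adjoints reverses products, hence the opposite group; powers of one element are
  -- unaffected.
  let F : Aut G →* (Aut (Dual G))ᵐᵒᵖ :=
    { toFun := fun B => MulOpposite.op (adjoint B)
      map_one' := rfl
      map_mul' := fun _ _ => rfl }
  exact (congrArg MulOpposite.unop (map_zpow F A n)).symm

/-- The adjoint of `A` maps the annihilator of `H` onto the annihilator of the preimage of `H`. -/
theorem image_adjoint_annihilator (A : Aut G) (H : AddSubgroup G) :
    adjoint A '' (annihilator H : Set (Dual G)) = annihilator (imageSubgroup A⁻¹ H) := by
  ext γ
  constructor
  · rintro ⟨δ, hδ, rfl⟩ _ ⟨x, hx, rfl⟩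
    change pairing (A⁻¹ x) (adjoint A δ) = 1
    rw [← pairing_adjoint, apply_inv_self]
    exact hδ x hx
  · intro hγ
    refine ⟨(adjoint A)⁻¹ γ, fun x hx => ?_, apply_inv_self (adjoint A) γ⟩
    exact hγ (A⁻¹ x) ⟨x, hx, rfl⟩

variable [IsTopologicalAddGroup G] {H : AddSubgroup G}

theorem subset_image_iff_annihilator (hHo : IsOpen (H : Set G)) (A : Aut G) :
    (H : Set G) ⊆ A '' H ↔
      (annihilator H : Set (Dual G)) ⊆ adjoint A '' (annihilator H : Set (Dual G)) := by
  rw [image_adjoint_annihilator, SetLike.coe_subset_coe, annihilator_le_annihilator_iff hHo,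
    imageSubgroup_inv_le_iff]

theorem ssubset_image_iff_annihilator (hHo : IsOpen (H : Set G)) (A : Aut G) :
    (H : Set G) ⊂ A '' H ↔
      (annihilator H : Set (Dual G)) ⊂ adjoint A '' (annihilator H : Set (Dual G)) := by
  refine and_congr (subset_image_iff_annihilator hHo A) (not_congr ?_)
  rw [image_adjoint_annihilator]
  change _ ↔ annihilator (imageSubgroup A⁻¹ H) ≤ annihilator H
  rw [annihilator_le_annihilator_iff (isOpen_imageSubgroup A⁻¹ hHo), le_imageSubgroup_inv_iff]

omit [IsTopologicalAddGroup G] in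
theorem antitone_imageSubgroup (A : Aut G) (hA : (H : Set G) ⊆ A '' H) :
    Antitone fun n : ℕ => imageSubgroup (A ^ n)⁻¹ H := by
  refine antitone_nat_of_succ_le fun n => ?_
  rintro _ ⟨x, hx, rfl⟩
  obtain ⟨y, hy, rfl⟩ := hA hx
  refine ⟨y, hy, ?_⟩
  change (A ^ n)⁻¹ y = (A ^ (n + 1))⁻¹ (A y)
  rw [← mul_apply, pow_succ', mul_inv_rev, inv_mul_cancel_right]

theorem iInter_image_eq_zero_iff [T2Space G] (hHc : IsCompact (H : Set G))
    (hHo : IsOpen (H : Set G)) (A : Aut G) (hA : (H : Set G) ⊆ A '' H) :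
    (⋂ n : ℤ, ⋂ _ : n ≤ 0, (A ^ n : Aut G) '' (H : Set G)) = {0} ↔
      (⋃ n : ℤ, ⋃ _ : 0 ≤ n, (adjoint A ^ n : Aut (Dual G)) ''
        (annihilator H : Set (Dual G))) = Set.univ := by
  have hinter : (⋂ n : ℤ, ⋂ _ : n ≤ 0, (A ^ n : Aut G) '' (H : Set G)) =
      ⋂ n : ℕ, (imageSubgroup (A ^ n)⁻¹ H : Set G) := by
    ext x
    simp only [Set.mem_iInter, coe_imageSubgroup]
    refine ⟨fun h n => ?_, fun h n hn => ?_⟩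
    · simpa using h (-n) (by simp)
    · obtain ⟨m, rfl⟩ := Int.exists_eq_neg_ofNat hn
      simpa using h m
  have hunion : (⋃ n : ℤ, ⋃ _ : 0 ≤ n, (adjoint A ^ n : Aut (Dual G)) ''
      (annihilator H : Set (Dual G))) =
      ⋃ n : ℕ, (annihilator (imageSubgroup (A ^ n)⁻¹ H) : Set (Dual G)) := by
    ext γ
    simp only [Set.mem_iUnion, adjoint_zpow, image_adjoint_annihilator]
    refine ⟨fun ⟨n, hn, h⟩ => ?_, fun ⟨n, h⟩ => ⟨n, by simp, by simpa using h⟩⟩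
    obtain ⟨m, rfl⟩ := Int.eq_ofNat_of_zero_le hn
    exact ⟨m, by simpa using h⟩
  rw [hinter, hunion]
  refine ⟨fun h => Set.eq_univ_of_forall fun γ => Set.mem_iUnion.mpr ?_, fun h => ?_⟩
  · exact exists_mem_annihilator_of_iInter_eq (antitone_imageSubgroup A hA)
      (fun n => isCompact_imageSubgroup _ hHc) h γ
  · refine Set.eq_singleton_iff_unique_mem.mpr
      ⟨Set.mem_iInter.mpr fun n => zero_mem _, fun x hx => ?_⟩
    rw [Set.mem_iInter] at hx
    by_contra hx0
    -- The term `n = 0` is `H` itself, which brings `x` into a compact group.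
    have hxH : x ∈ H := by
      obtain ⟨y, hy, hyx⟩ := hx 0
      exact hyx ▸ hy
    obtain ⟨γ, hγ⟩ := exists_pairing_ne_one hHc hHo hxH hx0
    obtain ⟨n, hn⟩ := Set.mem_iUnion.mp (h.ge (Set.mem_univ γ))
    exact hγ (hn x (hx n))

end Automorphism

end LCAGroup

theorem lemma2p5 {G : Type*} [AddCommGroup G] [TopologicalSpace G] [IsTopologicalAddGroup G]
    [LocallyCompactSpace G] [T2Space G] (H : AddSubgroup G)
    (hHcompact : IsCompact (H : Set G)) (hHopen : IsOpen (H : Set G)) (A : LCAGroup.Aut G) :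
    ((H : Set G) ⊆ A '' (H : Set G) ↔
      (LCAGroup.annihilator H : Set (LCAGroup.Dual G)) ⊆
        LCAGroup.adjoint A '' (LCAGroup.annihilator H : Set (LCAGroup.Dual G))) ∧
    ((H : Set G) ⊂ A '' (H : Set G) ↔
      (LCAGroup.annihilator H : Set (LCAGroup.Dual G)) ⊂
        LCAGroup.adjoint A '' (LCAGroup.annihilator H : Set (LCAGroup.Dual G))) ∧
    ((H : Set G) ⊆ A '' (H : Set G) →
      ((⋂ n : ℤ, ⋂ _ : n ≤ 0, (A ^ n : LCAGroup.Aut G) '' (H : Set G)) = {0} ↔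
        (⋃ n : ℤ, ⋃ _ : 0 ≤ n, (LCAGroup.adjoint A ^ n : LCAGroup.Aut (LCAGroup.Dual G)) ''
          (LCAGroup.annihilator H : Set (LCAGroup.Dual G))) = Set.univ)) ∧
    (LCAGroup.IsExpansive A H ↔
      (LCAGroup.annihilator H : Set (LCAGroup.Dual G)) ⊂
        LCAGroup.adjoint A '' (LCAGroup.annihilator H : Set (LCAGroup.Dual G)) ∧
      (⋃ n : ℤ, ⋃ _ : 0 ≤ n, (LCAGroup.adjoint A ^ n : LCAGroup.Aut (LCAGroup.Dual G)) ''
          (LCAGroup.annihilator H : Set (LCAGroup.Dual G))) = Set.univ) := by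
  have hab := LCAGroup.ssubset_image_iff_annihilator hHopen A
  have hc := LCAGroup.iInter_image_eq_zero_iff hHcompact hHopen A
  refine ⟨LCAGroup.subset_image_iff_annihilator hHopen A, hab, hc, ?_⟩
  rw [← hab]
  exact and_congr_right fun h => hc h.subset
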